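/- Let $E$ be a countable set and let $r(x,y)\ge 0$, $x\neq y\in E$, be jump rates such that $\lambda(x)=\sum_{y\ne x} r(x,y)<\infty$ for every $x\in E$. Let $\{X_t : t\ge 0\}$ be the (minimal) continuous-time Markov chain on $E$ with these rates, that is, with generator $(Lf)(x)=\sum_{y} r(x,y)\,[f(y)-f(x)]$; from its explosion time on, if that time is finite, the chain sits in a cemetery outside $E$. Denote by $\mathbb{P}_x$ its law when started from $x$. Assume that the chain is irreducible (any state can be reached from any other one by finitely many jumps of positive rate) and that it admits a stationary measure $\mu$: a nonzero function $\mu:E\to[0,\infty)$, of possibly infinite total mass, such that $$\sum_{x\in E}\mu(x)\,\mathbb{P}_x[X_t=y]=\mu(y)\qquad\text{for all } t\ge 0,\ y\in E .$$ By irreducibility, $\mu(x)>0$ for every $x$. Let $r^*(x,y)=\mu(y)\,r(y,x)/\mu(x)$ be the jump rates of the chain reversed in time, and let $\{X^s_t : t\ge 0\}$ be the symmetric (reversible) version of $X_t$, i.e. the (minimal) continuous-time Markov chain on $E$ with jump rates $$r^s(x,y)=\tfrac12\{r(x,y)+r^*(x,y)\},$$ whose generator is the symmetric part $S=\tfrac12(L+L^*)$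 of $L$ in $L^2(\mu)$. A chain is called transient if, for every $x\in E$, started from $x$ it satisfies almost surely that the set of times $t\ge 0$ at which it is at $x$ is bounded. If $\{X^s_t : t\ge 0\}$ is transient, then $\{X_t : t\ge 0\}$ is transient. -/

import Mathlib

open MeasureTheory ProbabilityTheory
open scoped NNReal ENNReal

/-!
Continuous-time Markov chains on a countable state space `E`, given by their jump rates
`r x y`, `x ≠ y`, and realised by the usual construction: a discrete-time jump chain together
with independent exponential holding times. A path that explodes is sent to a cemetery state
`none` at the explosion time (the minimal process).
-/

namespace MarkovJump

/-- `r` is a family of jump rates: `r x y ≥ 0` for `x ≠ y`, there is no jump from a point to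
itself, and the total rate out of every point is finite. -/
structure IsJumpRates {E : Type*} (r : E → E → ℝ≥0) : Prop where
  diag : ∀ x, r x x = 0
  summable : ∀ x, Summable (r x)

/-- Every state can be reached from every state along jumps of positive rate. -/
def Irreducible {E : Type*} (r : E → E → ℝ≥0) : Prop :=
  ∀ x y, Relation.ReflTransGen (fun a b => 0 < r a b) x y

/-- The holding rate `lam(x) = ∑_y r(x,y)`. -/
noncomputable def holdingRate {E : Type*} (r : E → E → ℝ≥0) (x : E) : ℝ≥0∞ :=
  ∑' y, (r x y : ℝ≥0∞)

open Classical in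
/-- The jump probabilities `p(x,y) = r(x,y) / lam(x)`. A state with `lam(x) = 0` is absorbing.
(The value at `lam(x) = ∞` is irrelevant: rates are required to be summable.) -/
noncomputable def jumpProb {E : Type*} (r : E → E → ℝ≥0) (x : E) : PMF E :=
  if h : holdingRate r x ≠ 0 ∧ holdingRate r x ≠ ∞ then
    PMF.normalize (fun y => (r x y : ℝ≥0∞)) h.1 h.2
  else PMF.pure x

section Construction

variable {E : Type*} [Countable E] [MeasurableSpace E] [DiscreteMeasurableSpace E]

/-- The transition kernel of the jump chain. -/
noncomputable def jumpKernel (r : E → E → ℝ≥0) : Kernel E E where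
  toFun x := (jumpProb r x).toMeasure
  measurable' := .of_discrete

instance (r : E → E → ℝ≥0) : IsMarkovKernel (jumpKernel r) :=
  ⟨fun x => PMF.toMeasure.isProbabilityMeasure (jumpProb r x)⟩

/-- The law, on `E^ℕ`, of the jump chain `Y_0, Y_1, …` with transition kernel `jumpKernel r`
started from `Y_0 = x`. -/
noncomputable def jumpChainLaw (r : E → E → ℝ≥0) (x : E) : Measure (ℕ → E) :=
  Kernel.traj (X := fun _ => E)
    (fun n => (jumpKernel r).comap
      (fun h : (i : Finset.Iic n) → E => h ⟨n, Finset.mem_Iic.2 le_rfl⟩)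
      (measurable_pi_apply _)) 0 (fun _ => x)

/-- The sample space: a trajectory `Y` of the jump chain and a sequence `e` of clocks. -/
abbrev Sample (E : Type*) : Type _ := (ℕ → E) × (ℕ → ℝ)

/-- The probability `P_x`: the jump chain starts from `x`, and the clocks are independent of it
and i.i.d. exponential of parameter `1`. -/
noncomputable def pathLaw (r : E → E → ℝ≥0) (x : E) : Measure (Sample E) :=
  (jumpChainLaw r x).prod (Measure.infinitePi fun _ : ℕ => expMeasure 1)

/-- The `n`-th holding time `e_n / lam(Y_n)`: given the jump chain it is exponential of parameter
`lam(Y_n)`; it is infinite when `lam(Y_n) = 0`. -/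
noncomputable def holdingTime (r : E → E → ℝ≥0) (ω : Sample E) (n : ℕ) : ℝ≥0∞ :=
  ENNReal.ofReal (ω.2 n) / holdingRate r (ω.1 n)

/-- The time at which the `n`-th jump occurs (`0` for `n = 0`). -/
noncomputable def jumpTime (r : E → E → ℝ≥0) (ω : Sample E) (n : ℕ) : ℝ≥0∞ :=
  ∑ k ∈ Finset.range n, holdingTime r ω k

open Classical in
/-- The process: `X_t = Y_n` when the time `t` lies between the `n`-th jump time (included) and
the next one (excluded), and `X_t = none` when the path has exploded by time `t`. -/
noncomputable def process (r : E → E → ℝ≥0) (t : ℝ≥0) (ω : Sample E) : Option E :=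
  if h : ∃ n, jumpTime r ω n ≤ t ∧ (t : ℝ≥0∞) < jumpTime r ω (n + 1) then
    some (ω.1 (Nat.find h))
  else none

/-- The measure `μ` (finite on points, of possibly infinite total mass, not zero) is stationary
for the process: `∑_x μ(x) P_x[X_t = y] = μ(y)` for all `t ≥ 0` and `y`. -/
def IsStationary (r : E → E → ℝ≥0) (μ : E → ℝ≥0) : Prop :=
  (∃ x, μ x ≠ 0) ∧
    ∀ (t : ℝ≥0) (y : E), ∑' x, (μ x : ℝ≥0∞) * pathLaw r x {ω | process r t ω = some y} = μ y

/-- The process is transient: almost surely, it spends only a bounded set of times at its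
starting point, whatever this point is. -/
def Transient (r : E → E → ℝ≥0) : Prop :=
  ∀ x, ∀ᵐ ω ∂(pathLaw r x), BddAbove {t : ℝ≥0 | process r t ω = some x}

end Construction

/-- The rates `r*(x,y)` of the process reversed in time with respect to `μ`: they are given by
`μ(x) r*(x,y) = μ(y) r(y,x)`. -/
noncomputable def adjointRates {E : Type*} (r : E → E → ℝ≥0) (μ : E → ℝ≥0) (x y : E) : ℝ≥0 :=
  μ y * r y x / μ x

/-- The rates `(r + r*)/2` of the symmetric (reversible) version of the process, whose generator
is the symmetric part `(L + L*)/2` of the generator `L` in `L²(μ)`. -/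
noncomputable def symmetrizedRates {E : Type*} (r : E → E → ℝ≥0) (μ : E → ℝ≥0) (x y : E) : ℝ≥0 :=
  (r x y + adjointRates r μ x y) / 2

end MarkovJump

/-! Transience of either chain amounts to finiteness of the diagonal Green function of its jump
chain, so it suffices to bound the Green function of `r` by that of the symmetrized rates. Write
`c(x,y) = μ(x) r(x,y)`, `m = μ λ` and `s = μ λ^s`, with `λ`, `λ^s` the two holding rates.

Let `u` be the potential at `a` of the original jump chain, truncated in time and killed outside a
finite set. It satisfies `m u ≤ m 1_a + c u`; testing against `u` bounds the energy of `u` by `m(a)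
u(a)`, and this energy only sees the symmetric part of `c`. Let `v` be the Green function at `a` of
the symmetrized chain. It is positive and superharmonic with a unit source at `a`; testing against
`u² / v` gives the Hardy-type lower bound `s(a) u(a)² / v(a)` for the same energy. Hence `u(a) ≤
m(a) v(a) / s(a)`, uniformly in both truncations (`sq_div_le_of_superharmonic`,
`green_ne_top_of_symmetrizedRates`).

The comparison needs `s ≤ m`, which is subinvariance of `μ` for the generator; it comes from
stationarity at small times (`IsStationary.isSubinvariant`). Passing between processes and Green
functions uses Borel-Cantelli, a last-visit decomposition, and the independence of the clocks from
the jump chain. -/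

namespace MarkovJump

/-! ### Potentials and Green functions of nonnegative kernels. -/

section Potential

variable {E : Type*}

/-- The `n`-th power of the kernel `K`. -/
noncomputable def stepProb (K : E → E → ℝ≥0∞) : ℕ → E → E → ℝ≥0∞
  | 0, x, y => ({y} : Set E).indicator 1 x
  | n + 1, x, y => ∑' z, K x z * stepProb K n z y

/-- The potential at `a` of the kernel `K` before time `n`, that is `∑_{k < n} K^k(x,a)`. -/
noncomputable def potential (K : E → E → ℝ≥0∞) (a : E) : ℕ → E → ℝ≥0∞
  | 0, _ => 0
  | n + 1, x => ({a} : Set E).indicator 1 x + ∑' z, K x z * potential K a n z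

/-- The Green function `∑_k K^k(x,y)`. -/
noncomputable def green (K : E → E → ℝ≥0∞) (x y : E) : ℝ≥0∞ :=
  ∑' n, stepProb K n x y

lemma potential_eq_sum (K : E → E → ℝ≥0∞) (a : E) (n : ℕ) (x : E) :
    potential K a n x = ∑ k ∈ Finset.range n, stepProb K k x a := by
  induction n generalizing x with
  | zero => simp [potential]
  | succ n ih =>
    rw [Finset.sum_range_succ']
    simp only [potential, stepProb, ih, Finset.mul_sum]
    rw [add_comm, Summable.tsum_finsetSum fun _ _ => ENNReal.summable]

lemma green_eq_add_tsum (K : E → E → ℝ≥0∞) (x a : E) :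
    green K x a = ({a} : Set E).indicator 1 x + ∑' z, K x z * green K z a := by
  rw [green, tsum_eq_zero_add' ENNReal.summable]
  simp only [stepProb, green, ← ENNReal.tsum_mul_left]
  rw [ENNReal.tsum_comm]

/-- `stepProb` unfolds at the first step, whereas the Markov property of the path law adds a last
step. -/
lemma stepProb_succ' (K : E → E → ℝ≥0∞) (n : ℕ) (x y : E) :
    stepProb K (n + 1) x y = ∑' z, stepProb K n x z * K z y := by
  induction n generalizing x with
  | zero =>
    simp only [stepProb]
    rw [tsum_eq_single y, tsum_eq_single x]
    · simp
    · intro z hz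
      simp [hz.symm]
    · intro z hz
      simp [hz]
  | succ n ih =>
    rw [stepProb]
    simp_rw [ih]
    simp only [stepProb, ← ENNReal.tsum_mul_left, ← ENNReal.tsum_mul_right]
    rw [ENNReal.tsum_comm]
    simp_rw [mul_assoc]

/-- Since `K b c * green K c a ≤ green K b a`, finiteness passes forward along each possible jump.
-/
lemma green_ne_top_of_irreducible {K : E → E → ℝ≥0∞} {x a : E} (h : green K x a ≠ ∞)
    {y : E} (hy : Relation.ReflTransGen (fun b c => K b c ≠ 0) x y) : green K y a ≠ ∞ := by
  induction hy with
  | refl => exact h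
  | @tail b c _ hbc ih =>
    intro hc
    refine ih (top_unique ?_)
    calc ∞ = K b c * green K c a := by rw [hc, ENNReal.mul_top hbc]
      _ ≤ ∑' z, K b z * green K z a := ENNReal.le_tsum c
      _ ≤ green K b a := by rw [green_eq_add_tsum K b a]; exact le_add_self

lemma one_le_green_self (K : E → E → ℝ≥0∞) (a : E) : 1 ≤ green K a a := by
  rw [green_eq_add_tsum]
  simp

lemma green_ne_zero_of_irreducible {K : E → E → ℝ≥0∞} {x a : E}
    (hx : Relation.ReflTransGen (fun b c => K b c ≠ 0) x a) : green K x a ≠ 0 := by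
  induction hx using Relation.ReflTransGen.head_induction_on with
  | refl => exact (zero_lt_one.trans_le (one_le_green_self K a)).ne'
  | @head b c hbc _ ih =>
    have h : K b c * green K c a ≤ green K b a := by
      rw [green_eq_add_tsum K b a]
      exact (ENNReal.le_tsum (f := fun z => K b z * green K z a) c).trans le_add_self
    exact fun h0 => mul_ne_zero hbc ih (le_zero_iff.1 (h0 ▸ h))

/-- The kernel `K` killed outside the finite set `F`. -/
noncomputable def killed (K : E → E → ℝ≥0∞) (F : Finset E) (x y : E) : ℝ≥0∞ :=
  (F : Set E).indicator (K x) y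

lemma tsum_killed (K : E → E → ℝ≥0∞) (F : Finset E) (x : E) (f : E → ℝ≥0∞) :
    ∑' z, killed K F x z * f z = ∑ z ∈ F, K x z * f z := by
  rw [tsum_eq_sum (s := F)]
  · refine Finset.sum_congr rfl fun z hz => ?_
    simp [killed, hz]
  · intro z hz
    simp [killed, hz]

lemma potential_mono {K K' : E → E → ℝ≥0∞} (h : ∀ x y, K x y ≤ K' x y) (a : E) (n : ℕ) (x : E) :
    potential K a n x ≤ potential K' a n x := by
  induction n generalizing x with
  | zero => simp [potential]
  | succ n ih =>
    simp only [potential]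
    gcongr with z
    · exact h x z
    · exact ih z

/-- Combined with the recursion, this makes the potential before time `n` a subsolution of the
Poisson equation with source at `a`. -/
lemma potential_le_succ (K : E → E → ℝ≥0∞) (a : E) (n : ℕ) (x : E) :
    potential K a n x ≤ potential K a (n + 1) x := by
  rw [potential_eq_sum, potential_eq_sum, Finset.sum_range_succ]
  exact le_self_add

lemma potential_ne_top {K : E → E → ℝ≥0∞} (h : ∀ x, ∑' y, K x y ≤ 1) (a : E) (n : ℕ) (x : E) :
    potential K a n x ≠ ∞ := by
  suffices H : potential K a n x ≤ n from ne_top_of_le_ne_top (ENNReal.natCast_ne_top n) H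
  induction n generalizing x with
  | zero => simp [potential]
  | succ n ih =>
    simp only [potential]
    rw [Nat.cast_succ, add_comm]
    refine add_le_add ?_ (Set.indicator_le_self' (by simp) x)
    calc ∑' z, K x z * potential K a n z ≤ ∑' z, K x z * n := by
          gcongr with z
          exact ih z
      _ = (∑' z, K x z) * n := ENNReal.tsum_mul_right
      _ ≤ 1 * n := by gcongr; exact h x
      _ = n := one_mul _

lemma killed_mono (K : E → E → ℝ≥0∞) {F G : Finset E} (h : F ⊆ G) (x y : E) :
    killed K F x y ≤ killed K G x y :=
  Set.indicator_le_indicator_of_subset (Finset.coe_subset.2 h) (fun _ => zero_le) y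

lemma killed_le (K : E → E → ℝ≥0∞) (F : Finset E) (x y : E) : killed K F x y ≤ K x y :=
  Set.indicator_le_self _ _ y

open Classical in
-- Monotone convergence along finite sets: it reduces the energy estimate to finite sums, which can
-- be rearranged freely.
lemma potential_le_iSup_killed (K : E → E → ℝ≥0∞) (a : E) (n : ℕ) (x : E) :
    potential K a n x ≤ ⨆ F : Finset E, potential (killed K F) a n x := by
  induction n generalizing x with
  | zero => simp [potential]
  | succ n ih =>
    simp only [potential, ← ENNReal.add_iSup]
    gcongr
    rw [ENNReal.tsum_eq_iSup_sum]
    refine iSup_le fun H => ?_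
    calc ∑ z ∈ H, K x z * potential K a n z
        ≤ ∑ z ∈ H, ⨆ F : Finset E, K x z * potential (killed K F) a n z := by
          refine Finset.sum_le_sum fun z _ => ?_
          rw [← ENNReal.mul_iSup]
          gcongr
          exact ih z
      _ = ⨆ F : Finset E, ∑ z ∈ H, K x z * potential (killed K F) a n z := by
          refine ENNReal.finsetSum_iSup_of_monotone fun z F G hFG => ?_
          gcongr
          exact potential_mono (fun x y => killed_mono K hFG x y) a n z
      _ ≤ ⨆ F : Finset E, ∑' z, killed K F x z * potential (killed K F) a n z := by
          refine iSup_le fun F => le_iSup_of_le (F ∪ H) ?_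
          rw [tsum_killed]
          calc ∑ z ∈ H, K x z * potential (killed K F) a n z
              ≤ ∑ z ∈ F ∪ H, K x z * potential (killed K F) a n z :=
                Finset.sum_le_sum_of_subset Finset.subset_union_right
            _ ≤ _ := by
                gcongr with z
                exact potential_mono (fun x y => killed_mono K Finset.subset_union_left x y) a n z

end Potential

/-! ### The energy inequality on a finite set. -/

section Energy

variable {E : Type*}

/-- Comparison of the energies of a function `u` for a form and for its symmetric part, the latter
being bounded below with the help of a positive superharmonic function `v`. -/
lemma sq_div_le_of_superharmonic {F : Finset E} {a : E} (ha : a ∈ F) {c : E → E → ℝ}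
    {m s u v : E → ℝ} (hc : ∀ x y, 0 ≤ c x y) (hs : ∀ x ∈ F, s x ≤ m x)
    (hu : ∀ x ∈ F, 0 ≤ u x) (hv : ∀ x ∈ F, 0 < v x)
    (h1 : ∀ x ∈ F, m x * u x ≤ ({a} : Set E).indicator m x + ∑ y ∈ F, c x y * u y)
    (h2 : ∀ x ∈ F, ({a} : Set E).indicator s x + ∑ y ∈ F, (c x y + c y x) / 2 * v y
      ≤ s x * v x) :
    s a * (u a ^ 2 / v a) ≤ m a * u a := by
  classical
  -- The subsolution property of `u`, tested against `u`.
  have e1 : ∑ x ∈ F, m x * u x ^ 2 ≤ m a * u a + ∑ x ∈ F, ∑ y ∈ F, c x y * (u x * u y) := by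
    calc ∑ x ∈ F, m x * u x ^ 2 = ∑ x ∈ F, (m x * u x) * u x :=
          Finset.sum_congr rfl fun x _ => by ring
      _ ≤ ∑ x ∈ F, (({a} : Set E).indicator m x + ∑ y ∈ F, c x y * u y) * u x :=
          Finset.sum_le_sum fun x hx => mul_le_mul_of_nonneg_right (h1 x hx) (hu x hx)
      _ = _ := by
          simp_rw [add_mul, Finset.sum_add_distrib]
          congr 1
          · rw [Finset.sum_eq_single_of_mem a ha]
            · simp
            · intro b _ hb
              simp [hb]
          · refine Finset.sum_congr rfl fun x _ => ?_
            rw [Finset.sum_mul]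
            exact Finset.sum_congr rfl fun y _ => by ring
  -- The superharmonicity of `v`, tested against `u² / v`.
  have e2 : s a * (u a ^ 2 / v a)
      + ∑ x ∈ F, ∑ y ∈ F, (c x y + c y x) / 2 * (v y * (u x ^ 2 / v x))
      ≤ ∑ x ∈ F, s x * u x ^ 2 := by
    calc _ = ∑ x ∈ F, (({a} : Set E).indicator s x + ∑ y ∈ F, (c x y + c y x) / 2 * v y)
            * (u x ^ 2 / v x) := by
          simp_rw [add_mul _ _ (_ / v _), Finset.sum_add_distrib]
          congr 1
          · rw [Finset.sum_eq_single_of_mem a ha]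
            · simp
            · intro b _ hb
              simp [hb]
          · refine Finset.sum_congr rfl fun x _ => ?_
            rw [Finset.sum_mul]
            exact Finset.sum_congr rfl fun y _ => by ring
      _ ≤ ∑ x ∈ F, (s x * v x) * (u x ^ 2 / v x) :=
          Finset.sum_le_sum fun x hx => mul_le_mul_of_nonneg_right (h2 x hx)
            (div_nonneg (sq_nonneg _) (hv x hx).le)
      _ = _ := Finset.sum_congr rfl fun x hx => by
          have := (hv x hx).ne'
          field_simp
  have e3 : ∑ x ∈ F, ∑ y ∈ F, c x y * (u x * u y)
      ≤ ∑ x ∈ F, ∑ y ∈ F, (c x y + c y x) / 2 * (v y * (u x ^ 2 / v x)) := by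
    -- Exchanging `x` and `y` moves the symmetrization from `c` to `g`; the bound `2 u(x) u(y) ≤
    -- v(y) u(x)² / v(x) + v(x) u(y)² / v(y)` then applies term by term.
    have hsym : ∀ g : E → E → ℝ, ∑ x ∈ F, ∑ y ∈ F, (c x y + c y x) / 2 * g x y
        = ∑ x ∈ F, ∑ y ∈ F, c x y * ((g x y + g y x) / 2) := by
      intro g
      have : ∑ x ∈ F, ∑ y ∈ F, c y x * g x y = ∑ x ∈ F, ∑ y ∈ F, c x y * g y x :=
        Finset.sum_comm
      calc _ = (∑ x ∈ F, ∑ y ∈ F, c x y * g x y + ∑ x ∈ F, ∑ y ∈ F, c y x * g x y) / 2 := by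
            simp_rw [← Finset.sum_add_distrib, Finset.sum_div]
            exact Finset.sum_congr rfl fun x _ => Finset.sum_congr rfl fun y _ => by ring
        _ = _ := by
            rw [this]
            simp_rw [← Finset.sum_add_distrib, Finset.sum_div]
            exact Finset.sum_congr rfl fun x _ => Finset.sum_congr rfl fun y _ => by ring
    rw [hsym]
    refine Finset.sum_le_sum fun x hx => Finset.sum_le_sum fun y hy =>
      mul_le_mul_of_nonneg_left ?_ (hc x y)
    have hx' := hv x hx
    have hy' := hv y hy
    have key : v y * (u x ^ 2 / v x) + v x * (u y ^ 2 / v y) - 2 * (u x * u y)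
        = (v y * u x - v x * u y) ^ 2 / (v x * v y) := by
      field_simp
      ring
    have : 0 ≤ (v y * u x - v x * u y) ^ 2 / (v x * v y) := by positivity
    linarith
  have e4 : ∑ x ∈ F, s x * u x ^ 2 ≤ ∑ x ∈ F, m x * u x ^ 2 :=
    Finset.sum_le_sum fun x hx => mul_le_mul_of_nonneg_right (hs x hx) (sq_nonneg _)
  linarith

end Energy

/-! ### Comparison of the Green functions of a chain and of its symmetrization. -/

section Comparison

variable {E : Type*}

lemma jumpProb_apply {r : E → E → ℝ≥0} {x : E} (h0 : holdingRate r x ≠ 0)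
    (h : holdingRate r x ≠ ∞) (y : E) : jumpProb r x y = r x y / holdingRate r x := by
  rw [jumpProb, dif_pos ⟨h0, h⟩, div_eq_mul_inv]
  exact PMF.normalize_apply _ _ y

lemma IsJumpRates.holdingRate_ne_top {r : E → E → ℝ≥0} (hr : IsJumpRates r) (x : E) :
    holdingRate r x ≠ ∞ :=
  ENNReal.tsum_coe_ne_top_iff_summable.2 (hr.summable x)

lemma Irreducible.holdingRate_ne_zero [Nontrivial E] {r : E → E → ℝ≥0} (hirr : Irreducible r)
    (x : E) : holdingRate r x ≠ 0 := by
  obtain ⟨y, hy⟩ := exists_ne x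
  rcases (hirr x y).cases_head with h | ⟨z, hz, _⟩
  · exact absurd h.symm hy
  · intro h0
    rw [holdingRate, ENNReal.tsum_eq_zero] at h0
    exact hz.ne' (by simpa using h0 z)

/-- The function `μ` is subinvariant for the generator of the process. -/
def IsSubinvariant (r : E → E → ℝ≥0) (μ : E → ℝ≥0) : Prop :=
  ∀ y, ∑' x, (μ x : ℝ≥0∞) * r x y ≤ μ y * holdingRate r y

/-- If `μ c = 0`, subinvariance at `c` leaves no mass flowing into `c`, so `μ` vanishes at every `b`
with `r b c > 0`. -/
lemma IsSubinvariant.ne_zero {r : E → E → ℝ≥0} {μ : E → ℝ≥0} (h : IsSubinvariant r μ)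
    (hirr : Irreducible r) {x : E} (hx : μ x ≠ 0) (y : E) : μ y ≠ 0 := by
  induction hirr x y with
  | refl => exact hx
  | @tail b c _ hbc ih =>
    intro hc
    have h1 := (ENNReal.le_tsum (f := fun x => (μ x : ℝ≥0∞) * r x c) b).trans (h c)
    rw [hc, ENNReal.coe_zero, zero_mul, nonpos_iff_eq_zero] at h1
    simp [ih, hbc.ne'] at h1

lemma coe_mul_symmetrizedRates (r : E → E → ℝ≥0) {μ : E → ℝ≥0} {x : E} (hx : μ x ≠ 0) (y : E) :
    μ x * symmetrizedRates r μ x y = (μ x * r x y + μ y * r y x) / 2 := by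
  rw [symmetrizedRates, adjointRates]
  field_simp

/-- The symmetrized flow out of `x` is the mean of the outflow `μ(x) λ(x)` and of the inflow, which
subinvariance bounds by the same quantity. -/
lemma IsSubinvariant.holdingRate_symmetrizedRates_le {r : E → E → ℝ≥0} {μ : E → ℝ≥0}
    (h : IsSubinvariant r μ) {x : E} (hx : μ x ≠ 0) :
    holdingRate (symmetrizedRates r μ) x ≤ holdingRate r x := by
  have hx' : (μ x : ℝ≥0∞) ≠ 0 := by simpa using hx
  refine (ENNReal.mul_le_mul_iff_right hx' ENNReal.coe_ne_top).1 ?_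
  have e : ∀ y, (μ x : ℝ≥0∞) * symmetrizedRates r μ x y
      = (2 : ℝ≥0∞)⁻¹ * ((μ x : ℝ≥0∞) * r x y) + (2 : ℝ≥0∞)⁻¹ * ((μ y : ℝ≥0∞) * r y x) := by
    intro y
    rw [← ENNReal.coe_mul, coe_mul_symmetrizedRates r hx, ENNReal.coe_div two_ne_zero, ← mul_add,
      div_eq_mul_inv, mul_comm]
    push_cast
    rfl
  rw [holdingRate, ← ENNReal.tsum_mul_left]
  simp_rw [e]
  rw [ENNReal.tsum_add]
  simp_rw [ENNReal.tsum_mul_left]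
  calc _ ≤ (2 : ℝ≥0∞)⁻¹ * (μ x * holdingRate r x) + (2 : ℝ≥0∞)⁻¹ * (μ x * holdingRate r x) := by
        gcongr
        · rfl
        · exact h x
    _ = _ := by rw [← add_mul, ENNReal.inv_two_add_inv_two, one_mul]

lemma Irreducible.symmetrizedRates {r : E → E → ℝ≥0} (hirr : Irreducible r) (μ : E → ℝ≥0) :
    Irreducible (symmetrizedRates r μ) := fun x y =>
  Relation.ReflTransGen.mono (fun a b (h : 0 < r a b) => by
    rw [MarkovJump.symmetrizedRates]
    positivity) x y (hirr x y)

lemma reflTransGen_jumpProb {r : E → E → ℝ≥0} (hirr : Irreducible r)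
    (h0 : ∀ x, holdingRate r x ≠ 0) (h : ∀ x, holdingRate r x ≠ ∞) (x y : E) :
    Relation.ReflTransGen (fun b c => jumpProb r b c ≠ 0) x y :=
  Relation.ReflTransGen.mono (fun a b (hab : 0 < r a b) => by
    rw [jumpProb_apply (h0 a) (h a)]
    simp [h a, hab.ne']) x y (hirr x y)

/-- The Green function of a chain is finite if the one of its symmetrization is. -/
theorem green_ne_top_of_symmetrizedRates {r : E → E → ℝ≥0} {μ : E → ℝ≥0}
    (hirr : Irreducible r) (h0 : ∀ x, holdingRate r x ≠ 0) (htop : ∀ x, holdingRate r x ≠ ∞)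
    (hs0 : ∀ x, holdingRate (symmetrizedRates r μ) x ≠ 0) (hμ : ∀ x, μ x ≠ 0)
    (hsub : IsSubinvariant r μ) {a : E}
    (hg : green (fun x => jumpProb (symmetrizedRates r μ) x) a a ≠ ∞) :
    green (fun x => jumpProb r x) a a ≠ ∞ := by
  classical
  set rs := symmetrizedRates r μ with hrs
  set K : E → E → ℝ≥0∞ := fun x => jumpProb r x with hK
  set Q : E → E → ℝ≥0∞ := fun x => jumpProb rs x with hQ
  have hsl : ∀ x, holdingRate rs x ≤ holdingRate r x := fun x =>
    hsub.holdingRate_symmetrizedRates_le (hμ x)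
  have hs1 : ∀ x, holdingRate rs x ≠ ∞ := fun x => ne_top_of_le_ne_top (htop x) (hsl x)
  have hKa : ∀ x y, K x y = r x y / holdingRate r x := fun x y => jumpProb_apply (h0 x) (htop x) y
  have hQa : ∀ x y, Q x y = rs x y / holdingRate rs x :=
    fun x y => jumpProb_apply (hs0 x) (hs1 x) y
  have hKt : ∀ x y, K x y ≠ ∞ := fun x y => (jumpProb r x).apply_ne_top y
  have hQt : ∀ x y, Q x y ≠ ∞ := fun x y => (jumpProb rs x).apply_ne_top y
  have hQirr := reflTransGen_jumpProb (hirr.symmetrizedRates μ) hs0 hs1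
  have hvt : ∀ x, green Q x a ≠ ∞ := fun x => green_ne_top_of_irreducible hg (hQirr a x)
  have hv0 : ∀ x, green Q x a ≠ 0 := fun x => green_ne_zero_of_irreducible (hQirr x a)
  set l : E → ℝ := fun x => (holdingRate r x).toReal with hl
  set ls : E → ℝ := fun x => (holdingRate rs x).toReal with hls
  set v : E → ℝ := fun x => (green Q x a).toReal with hv
  have hlpos : ∀ x, 0 < l x := fun x => ENNReal.toReal_pos (h0 x) (htop x)
  have hlspos : ∀ x, 0 < ls x := fun x => ENNReal.toReal_pos (hs0 x) (hs1 x)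
  have hvpos : ∀ x, 0 < v x := fun x => ENNReal.toReal_pos (hv0 x) (hvt x)
  have hμpos : ∀ x, (0 : ℝ) < μ x := fun x => NNReal.coe_pos.2 (pos_iff_ne_zero.2 (hμ x))
  have hind : ∀ (w : E → ℝ) (x : E),
      w x * (({a} : Set E).indicator 1 x : ℝ≥0∞).toReal = ({a} : Set E).indicator w x := by
    intro w x
    by_cases hx : x = a <;> simp [hx]
  have hind_top : ∀ x, (({a} : Set E).indicator 1 x : ℝ≥0∞) ≠ ∞ := by
    intro x
    by_cases hx : x = a <;> simp [hx]
  -- This is `m(a) v(a) / s(a)`, the energy inequality divided by `u(a)`; it depends neither on `F`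
  -- nor on `n`.
  set B : ℝ := μ a * l a * v a / (μ a * ls a) with hB
  have main : ∀ (F : Finset E) (n : ℕ), a ∈ F →
      potential (killed K F) a n a ≤ ENNReal.ofReal B := by
    intro F n ha
    have hpt : ∀ n x, potential (killed K F) a n x ≠ ∞ := fun n x =>
      potential_ne_top (fun x => (ENNReal.tsum_le_tsum (killed_le K F x)).trans
        (jumpProb r x).tsum_coe.le) a n x
    set u : E → ℝ := fun x => (potential (killed K F) a n x).toReal with hu
    have key := sq_div_le_of_superharmonic (F := F) ha (c := fun x y => (μ x : ℝ) * r x y)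
      (m := fun x => μ x * l x) (s := fun x => μ x * ls x) (u := u) (v := v)
      (fun x y => by positivity)
      (fun x _ => mul_le_mul_of_nonneg_left (ENNReal.toReal_mono (htop x) (hsl x)) (hμpos x).le)
      (fun x _ => ENNReal.toReal_nonneg) (fun x _ => hvpos x) ?_ ?_
    · have hupos : 0 ≤ u a := ENNReal.toReal_nonneg
      have huB : u a ≤ B := by
        rw [hB, le_div_iff₀ (mul_pos (hμpos a) (hlspos a))]
        rcases hupos.eq_or_lt with h | h
        · rw [← h, zero_mul]
          have := hμpos a; have := hlpos a; have := hvpos a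
          positivity
        · have hva := hvpos a
          rw [mul_div_assoc', div_le_iff₀ hva] at key
          refine le_of_mul_le_mul_left ?_ h
          nlinarith
      calc potential (killed K F) a n a = ENNReal.ofReal (u a) :=
            (ENNReal.ofReal_toReal (hpt n a)).symm
        _ ≤ _ := ENNReal.ofReal_le_ofReal huB
    · intro x _
      have h1 := potential_le_succ (killed K F) a n x
      rw [potential, tsum_killed] at h1
      have hst : ∀ y ∈ F, K x y * potential (killed K F) a n y ≠ ∞ := fun y _ =>
        ENNReal.mul_ne_top (hKt x y) (hpt n y)
      have h2 := ENNReal.toReal_mono (ENNReal.add_ne_top.2 ⟨hind_top x,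
        ENNReal.sum_ne_top.2 hst⟩) h1
      rw [ENNReal.toReal_add (hind_top x) (ENNReal.sum_ne_top.2 hst), ENNReal.toReal_sum hst] at h2
      have h3 := mul_le_mul_of_nonneg_left h2 (mul_pos (hμpos x) (hlpos x)).le
      rw [mul_add, hind (fun x => μ x * l x)] at h3
      refine h3.trans_eq ?_
      congr 1
      rw [Finset.mul_sum]
      refine Finset.sum_congr rfl fun y _ => ?_
      have := (hlpos x).ne'
      rw [ENNReal.toReal_mul, hKa, ENNReal.toReal_div, ENNReal.coe_toReal]
      change (μ x : ℝ) * l x * (r x y / l x * u y) = _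
      field_simp
    · intro x _
      -- Dropping the terms outside `F` keeps `v` superharmonic, so the symmetrized chain needs no
      -- killing.
      have h1 : ({a} : Set E).indicator 1 x + ∑ y ∈ F, Q x y * green Q y a ≤ green Q x a := by
        rw [green_eq_add_tsum Q x a]
        gcongr
        exact ENNReal.sum_le_tsum F
      have hst : ∀ y ∈ F, Q x y * green Q y a ≠ ∞ := fun y _ =>
        ENNReal.mul_ne_top (hQt x y) (hvt y)
      have h2 := ENNReal.toReal_mono (hvt x) h1
      rw [ENNReal.toReal_add (hind_top x) (ENNReal.sum_ne_top.2 hst), ENNReal.toReal_sum hst] at h2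
      have h3 := mul_le_mul_of_nonneg_left h2 (mul_pos (hμpos x) (hlspos x)).le
      rw [mul_add, hind (fun x => μ x * ls x)] at h3
      refine le_of_eq_of_le ?_ h3
      congr 1
      rw [Finset.mul_sum]
      refine Finset.sum_congr rfl fun y _ => ?_
      have := (hlspos x).ne'
      rw [ENNReal.toReal_mul, hQa, ENNReal.toReal_div, ENNReal.coe_toReal]
      have h4 : (μ x : ℝ) * rs x y = (μ x * r x y + μ y * r y x) / 2 := by
        exact_mod_cast congrArg ((↑) : ℝ≥0 → ℝ) (coe_mul_symmetrizedRates r (hμ x) y)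
      change _ = (μ x : ℝ) * ls x * (rs x y / ls x * v y)
      rw [← h4]
      field_simp
  refine ne_top_of_le_ne_top (ENNReal.ofReal_ne_top (r := B)) ?_
  rw [green, ENNReal.tsum_eq_iSup_nat]
  refine iSup_le fun n => ?_
  rw [← potential_eq_sum]
  refine (potential_le_iSup_killed K a n a).trans (iSup_le fun F => ?_)
  exact (potential_mono (killed_mono K (Finset.subset_insert a F)) a n a).trans
    (main _ n (Finset.mem_insert_self a F))

end Comparison

/-! ### Visits of the jump chain and its Green function. -/

section JumpChain

variable {E : Type*} [MeasurableSpace E] [DiscreteMeasurableSpace E]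

lemma measurableSet_apply_eq {ι : Type*} (i : ι) (y : E) :
    MeasurableSet {g : ι → E | g i = y} :=
  (measurable_pi_apply i : Measurable fun g : ι → E => g i) (MeasurableSet.of_discrete (s := {y}))

instance (r : E → E → ℝ≥0) (x : E) : IsProbabilityMeasure (jumpChainLaw r x) := by
  unfold jumpChainLaw
  infer_instance

lemma jumpChainLaw_zero (r : E → E → ℝ≥0) (x : E) (s : Set E) :
    jumpChainLaw r x {Y | Y 0 ∈ s} = s.indicator 1 x := by
  have h := Kernel.traj_map_frestrictLe_apply (X := fun _ => E)
    (κ := fun n => (jumpKernel r).comap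
      (fun h : (i : Finset.Iic n) → E => h ⟨n, Finset.mem_Iic.2 le_rfl⟩)
      (measurable_pi_apply _)) 0 0 (fun _ => x)
  rw [Kernel.partialTraj_self, Kernel.id_apply] at h
  have hm : MeasurableSet {g : (i : Finset.Iic 0) → E | g ⟨0, Finset.mem_Iic.2 le_rfl⟩ ∈ s} :=
    measurable_pi_apply _ (MeasurableSet.of_discrete (s := s))
  have h2 := congrArg (fun m => m {g | g ⟨0, Finset.mem_Iic.2 le_rfl⟩ ∈ s}) h
  rw [Measure.map_apply (Preorder.measurable_frestrictLe _) hm, Measure.dirac_apply' _ hm] at h2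
  exact h2

lemma ae_jumpChainLaw_zero (r : E → E → ℝ≥0) (x : E) : ∀ᵐ Y ∂jumpChainLaw r x, Y 0 = x := by
  have h := jumpChainLaw_zero r x {x}ᶜ
  rwa [Set.indicator_of_notMem (by simp)] at h

/-- The Markov property of the jump chain. -/
lemma jumpChainLaw_succ (r : E → E → ℝ≥0) (x : E) (n : ℕ) {B : Set ((i : Finset.Iic n) → E)}
    (hB : MeasurableSet B) (y z : E) :
    jumpChainLaw r x {Y | Preorder.frestrictLe n Y ∈ B ∧ Y n = y ∧ Y (n + 1) = z}
      = jumpChainLaw r x {Y | Preorder.frestrictLe n Y ∈ B ∧ Y n = y} * jumpProb r y z := by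
  have h := Kernel.partialTraj_compProd_eq_map_traj (X := fun _ => E)
    (κ := fun n => (jumpKernel r).comap
      (fun h : (i : Finset.Iic n) → E => h ⟨n, Finset.mem_Iic.2 le_rfl⟩)
      (measurable_pi_apply _)) (Nat.zero_le n) (x₀ := fun _ => x)
  rw [← Kernel.traj_map_frestrictLe_apply] at h
  set C : Set ((i : Finset.Iic n) → E) := {g | g ∈ B ∧ g ⟨n, Finset.mem_Iic.2 le_rfl⟩ = y} with hC
  have hCm : MeasurableSet C :=
    hB.inter (measurableSet_apply_eq _ y)
  have h2 := congrArg (fun m => m (C ×ˢ {z})) h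
  rw [Measure.compProd_apply_prod hCm .of_discrete,
    Measure.map_apply (by fun_prop) (hCm.prod .of_discrete),
    -- On `C` the current state is `y`, so the transition probability to `z` is constant there.
    setLIntegral_congr_fun (g := fun _ => jumpProb r y z) hCm, setLIntegral_const,
    Measure.map_apply (Preorder.measurable_frestrictLe _) hCm, mul_comm] at h2
  · rw [jumpChainLaw]
    refine Eq.trans ?_ h2.symm
    congr 1
    ext Y
    simp [hC, and_assoc]
  · intro g hg
    simp only [Kernel.comap_apply, hg.2]
    exact PMF.toMeasure_apply_singleton _ _ .of_discrete

variable [Countable E]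

lemma jumpChainLaw_eq_stepProb (r : E → E → ℝ≥0) (x : E) (n : ℕ) (y : E) :
    jumpChainLaw r x {Y | Y n = y} = stepProb (fun x => jumpProb r x) n x y := by
  induction n generalizing y with
  | zero => exact jumpChainLaw_zero r x {y}
  | succ n ih =>
    rw [stepProb_succ']
    simp_rw [← ih]
    have h1 := fun z => jumpChainLaw_succ r x n (B := Set.univ) .univ z y
    simp only [Set.mem_univ, true_and] at h1
    simp_rw [← h1]
    rw [← measure_iUnion]
    · congr 1
      ext Y
      simp
    · intro z z' hz
      exact Set.disjoint_left.2 fun Y hY hY' => hz (hY.1.symm.trans hY'.1)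
    · intro z
      exact (measurableSet_apply_eq n z).inter
        (measurableSet_apply_eq (n + 1) y)

/-- Borel-Cantelli: if the Green function is finite, there are finitely many visits. -/
lemma ae_finite_visits {r : E → E → ℝ≥0} {x : E}
    (h : green (fun x => jumpProb r x) x x ≠ ∞) :
    ∀ᵐ Y ∂jumpChainLaw r x, {n | Y n = x}.Finite := by
  refine ae_finite_setOfPred_mem (s := fun n => {Y : ℕ → E | Y n = x}) ?_
  simp_rw [jumpChainLaw_eq_stepProb]
  exact h

/-- The probability that the chain with kernel `K` avoids the point `a` at times `1, …, m`. -/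
noncomputable def avoidProb (K : E → E → ℝ≥0∞) (a : E) : ℕ → E → ℝ≥0∞
  | 0, _ => 1
  | m + 1, y => ∑' z, K y z * ({a}ᶜ : Set E).indicator (avoidProb K a m) z

/-- The past event `B` is arbitrary because the induction on `m` moves forward in time: the state
`y` at time `n` is absorbed into the past `B'` at time `n + 1`. -/
lemma jumpChainLaw_avoid (r : E → E → ℝ≥0) (x a : E) (m n : ℕ) {B : Set ((i : Finset.Iic n) → E)}
    (hB : MeasurableSet B) (y : E) :
    jumpChainLaw r x {Y | (Preorder.frestrictLe n Y ∈ B ∧ Y n = y) ∧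
        ∀ k < m, Y (n + k + 1) ≠ a}
      = jumpChainLaw r x {Y | Preorder.frestrictLe n Y ∈ B ∧ Y n = y}
        * avoidProb (fun x => jumpProb r x) a m y := by
  induction m generalizing n B y with
  | zero => simp [avoidProb]
  | succ m ih =>
    rw [avoidProb, ← ENNReal.tsum_mul_left]
    have hterm : ∀ z, jumpChainLaw r x {Y | Preorder.frestrictLe n Y ∈ B ∧ Y n = y}
        * (jumpProb r y z
          * ({a}ᶜ : Set E).indicator (avoidProb (fun x => jumpProb r x) a m) z)
        = jumpChainLaw r x {Y | ((Preorder.frestrictLe n Y ∈ B ∧ Y n = y) ∧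
          ∀ k < m + 1, Y (n + k + 1) ≠ a) ∧ Y (n + 1) = z} := by
      intro z
      by_cases hz : z = a
      · subst hz
        rw [Set.indicator_of_notMem (by simp), mul_zero, mul_zero, eq_comm]
        convert measure_empty (μ := jumpChainLaw r x)
        refine Set.eq_empty_of_forall_notMem fun Y hY => ?_
        exact hY.1.2 0 m.succ_pos hY.2
      · rw [Set.indicator_of_mem (by simpa using hz), ← mul_assoc, ← jumpChainLaw_succ r x n hB]
        let B' : Set ((i : Finset.Iic (n + 1)) → E) :=
          Preorder.frestrictLe₂ (π := fun _ => E) (Nat.le_add_right n 1) ⁻¹'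
            {g : (i : Finset.Iic n) → E | g ∈ B ∧ g ⟨n, Finset.mem_Iic.2 le_rfl⟩ = y}
        have hB' : MeasurableSet B' := Preorder.measurable_frestrictLe₂ _
          (hB.inter (measurableSet_apply_eq _ y))
        have h := ih (n + 1) hB' z
        have e : {Y : ℕ → E | Preorder.frestrictLe (n + 1) Y ∈ B' ∧ Y (n + 1) = z}
            = {Y : ℕ → E | Preorder.frestrictLe n Y ∈ B ∧ Y n = y ∧ Y (n + 1) = z} := by
          ext Y
          exact and_assoc
        rw [← e, ← h]
        congr 1
        ext Y
        constructor
        · rintro ⟨⟨hY1, hY2⟩, hY3⟩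
          refine ⟨⟨hY1, fun k hk => ?_⟩, hY2⟩
          rcases k with _ | k
          · exact fun h => hz (hY2.symm.trans h)
          · have := hY3 k (by omega)
            rwa [show n + (k + 1) + 1 = n + 1 + k + 1 by omega]
        · rintro ⟨⟨hY1, hY3⟩, hY2⟩
          refine ⟨⟨hY1, hY2⟩, fun k hk => ?_⟩
          have := hY3 (k + 1) (by omega)
          rwa [show n + (k + 1) + 1 = n + 1 + k + 1 by omega] at this
    simp_rw [hterm]
    have hmeas : MeasurableSet {Y : ℕ → E | (Preorder.frestrictLe n Y ∈ B ∧ Y n = y) ∧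
          ∀ k < m + 1, Y (n + k + 1) ≠ a} := by
      refine MeasurableSet.inter ((Preorder.measurable_frestrictLe n hB).inter
        (measurableSet_apply_eq n y)) ?_
      have : {Y : ℕ → E | ∀ k < m + 1, Y (n + k + 1) ≠ a}
          = ⋂ k, ⋂ _ : k < m + 1, (fun Y => Y (n + k + 1)) ⁻¹' {a}ᶜ := by
        ext
        simp
      change MeasurableSet {Y : ℕ → E | ∀ k < m + 1, Y (n + k + 1) ≠ a}
      rw [this]
      exact .iInter fun k => .iInter fun _ =>
        (measurableSet_apply_eq (n + k + 1) a).compl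
    rw [← measure_iUnion]
    · congr 1
      ext Y
      simp
    · intro z z' hz
      exact Set.disjoint_left.2 fun Y hY hY' => hz (hY.2.symm.trans hY'.2)
    · intro z
      exact hmeas.inter (measurableSet_apply_eq (n + 1) z)

/-- If there are finitely many visits, the Green function is finite, by a decomposition at the
last visit. -/
lemma green_ne_top_of_ae_finite_visits {r : E → E → ℝ≥0} {x : E}
    (h : ∀ᵐ Y ∂jumpChainLaw r x, {n | Y n = x}.Finite) :
    green (fun x => jumpProb r x) x x ≠ ∞ := by
  set A : ℕ → ℕ → Set (ℕ → E) := fun n m => {Y | Y n = x ∧ ∀ k < m, Y (n + k + 1) ≠ x} with hA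
  have hAm : ∀ n m, MeasurableSet (A n m) := by
    intro n m
    have : A n m = (fun Y => Y n) ⁻¹' {x} ∩
        ⋂ k, ⋂ _ : k < m, (fun Y => Y (n + k + 1)) ⁻¹' {x}ᶜ := by
      ext
      simp [hA]
    rw [this]
    exact (measurableSet_apply_eq n x).inter <|
      .iInter fun k => .iInter fun _ =>
        (measurableSet_apply_eq (n + k + 1) x).compl
  have hanti : ∀ n, Antitone (A n) := fun n m m' hm Y hY =>
    ⟨hY.1, fun k hk => hY.2 k (hk.trans_le hm)⟩
  set K : E → E → ℝ≥0∞ := fun x => jumpProb r x with hK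
  have hAp : ∀ n m, jumpChainLaw r x (A n m) = stepProb K n x x * avoidProb K x m x := by
    intro n m
    have := jumpChainLaw_avoid r x x m n (B := Set.univ) .univ x
    simp only [Set.mem_univ, true_and] at this
    rw [this, jumpChainLaw_eq_stepProb]
  -- The probability of never returning to `x`; then `⋂ m, A n m`, the event that `n` is the last
  -- visit, has probability `K^n(x,x) e`.
  set e : ℝ≥0∞ := ⨅ m, avoidProb K x m x with he
  have hL : ∀ n, jumpChainLaw r x (⋂ m, A n m) = stepProb K n x x * e := by
    intro n
    rw [(hanti n).measure_iInter (fun m => (hAm n m).nullMeasurableSet) ⟨0, measure_ne_top _ _⟩]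
    simp_rw [hAp]
    rw [he, ENNReal.mul_iInf' (fun h0 _ => ?_) fun _ => ⟨0⟩]
    rw [← jumpChainLaw_eq_stepProb] at h0
    exact absurd h0 (measure_ne_top _ _)
  have hdisj : Pairwise (Function.onFun Disjoint fun n => ⋂ m, A n m) := by
    have key : ∀ n n', n < n' → ∀ Y : ℕ → E, Y ∈ ⋂ m, A n m → Y ∉ ⋂ m, A n' m := by
      intro n n' hn Y hY hY'
      have h1 := (Set.mem_iInter.1 hY (n' - n)).2 (n' - n - 1) (by omega)
      rw [show n + (n' - n - 1) + 1 = n' by omega] at h1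
      exact h1 (Set.mem_iInter.1 hY' 0).1
    intro n n' hn
    refine Set.disjoint_left.2 fun Y hY hY' => ?_
    rcases lt_or_gt_of_ne hn with h | h
    · exact key n n' h Y hY hY'
    · exact key n' n h Y hY' hY
  have hun : jumpChainLaw r x (⋃ n, ⋂ m, A n m) = 1 := by
    rw [← measure_univ (μ := jumpChainLaw r x)]
    refine measure_congr (Filter.eventuallyEq_univ.2 ?_)
    filter_upwards [h, ae_jumpChainLaw_zero r x] with Y hY hY0
    obtain ⟨n, hn, hmax⟩ := hY.exists_maximal ⟨0, hY0⟩
    refine Set.mem_iUnion.2 ⟨n, Set.mem_iInter.2 fun m => ⟨hn, fun k _ hk => ?_⟩⟩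
    have := hmax hk (by omega)
    omega
  rw [measure_iUnion hdisj fun n => .iInter fun m => hAm n m] at hun
  simp_rw [hL] at hun
  -- The last-visit events are disjoint and cover almost every path, so the Green function times `e`
  -- equals `1`. An infinite Green function would make this product `0` or `∞`.
  rw [ENNReal.tsum_mul_right] at hun
  intro htop
  rw [green] at htop
  rw [htop] at hun
  by_cases he0 : e = 0
  · simp [he0] at hun
  · rw [ENNReal.top_mul he0] at hun
    exact ENNReal.top_ne_one hun

end JumpChain

/-! ### The exponential clocks. -/

section Clocks

instance : IsProbabilityMeasure (expMeasure 1) := isProbabilityMeasure_expMeasure one_pos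

lemma expMeasure_one_Iic {s : ℝ} (hs : 0 ≤ s) :
    expMeasure 1 (Set.Iic s) = ENNReal.ofReal (1 - Real.exp (-s)) := by
  rw [← ofReal_cdf, cdf_expMeasure_eq one_pos, if_pos hs, one_mul]

lemma expMeasure_one_Ioi {s : ℝ} (hs : 0 ≤ s) :
    expMeasure 1 (Set.Ioi s) = ENNReal.ofReal (Real.exp (-s)) := by
  rw [← Set.compl_Iic, prob_compl_eq_one_sub measurableSet_Iic, expMeasure_one_Iic hs,
    ← ENNReal.ofReal_one, ← ENNReal.ofReal_sub _ (by simpa using hs), sub_sub_cancel]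

lemma ae_clock_pos : ∀ᵐ e ∂(Measure.infinitePi fun _ : ℕ => expMeasure 1), ∀ n, 0 < e n := by
  refine ae_all_iff.2 fun n => ?_
  have h : expMeasure 1 (Set.Ioi 0)ᶜ = 0 := by
    rw [Set.compl_Ioi, expMeasure_one_Iic le_rfl]
    simp
  exact (measurePreserving_eval_infinitePi (fun _ : ℕ => expMeasure 1) n).quasiMeasurePreserving.ae h

/-- Along an infinite set of indices, infinitely many clocks are larger than `1`. -/
lemma ae_frequently_one_lt_clock {S : Set ℕ} (hS : S.Infinite) :
    ∀ᵐ e ∂(Measure.infinitePi fun _ : ℕ => expMeasure 1), {n | n ∈ S ∧ 1 < e n}.Infinite := by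
  set P := Measure.infinitePi fun _ : ℕ => expMeasure 1 with hP
  set φ : ℕ → ℕ := Nat.nth (· ∈ S) with hφ
  have hφm : StrictMono φ := Nat.nth_strictMono hS
  have hφS : ∀ n, φ n ∈ S := Nat.nth_mem_of_infinite hS
  have hind : iIndepFun (fun (n : ℕ) (e : ℕ → ℝ) => e n) P :=
    iIndepFun_infinitePi (X := fun _ x => x) fun _ => measurable_id
  have hm : ∀ n, MeasurableSet {e : ℕ → ℝ | 1 < e (φ n)} := fun n =>
    measurableSet_lt measurable_const (measurable_pi_apply (φ n))
  have hind2 : iIndepSet (fun n => {e : ℕ → ℝ | 1 < e (φ n)}) P := by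
    have h := hind.precomp hφm.injective
    refine (iIndepSet_iff_meas_biInter hm).2 fun s => ?_
    exact h.measure_inter_preimage_eq_mul s (sets := fun _ => Set.Ioi 1)
      fun _ _ => measurableSet_Ioi
  have hp : ∀ n, P {e : ℕ → ℝ | 1 < e (φ n)} = ENNReal.ofReal (Real.exp (-1)) := by
    intro n
    rw [← expMeasure_one_Ioi zero_le_one]
    exact (measurePreserving_eval_infinitePi (fun _ : ℕ => expMeasure 1) (φ n)).measure_preimage
      measurableSet_Ioi.nullMeasurableSet
  -- Second Borel-Cantelli lemma along the enumeration `φ` of `S`: the events are independent with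
  -- constant probability `exp (-1)`.
  have hlim := measure_limsup_eq_one hm hind2 (by
    simp_rw [hp]
    exact ENNReal.tsum_const_eq_top_of_ne_zero (by simp [Real.exp_pos]))
  have hae : ∀ᵐ e ∂P, e ∈ Filter.limsup (fun n => {e : ℕ → ℝ | 1 < e (φ n)}) Filter.atTop := by
    rw [← prob_compl_eq_zero_iff (MeasurableSet.measurableSet_limsup hm)] at hlim
    exact hlim
  filter_upwards [hae] with e he
  rw [Filter.mem_limsup_iff_frequently_mem, Nat.frequently_atTop_iff_infinite] at he
  refine (he.image hφm.injective.injOn).mono ?_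
  rintro _ ⟨n, hn, rfl⟩
  exact ⟨hφS n, hn⟩

end Clocks

/-! ### From visits of the jump chain to occupation times of the process. -/

section Paths

variable {E : Type*}

lemma jumpTime_mono (r : E → E → ℝ≥0) (ω : Sample E) : Monotone (jumpTime r ω) := fun _ _ h =>
  Finset.sum_le_sum_of_subset (Finset.range_mono h)

lemma process_eq_some {r : E → E → ℝ≥0} {ω : Sample E} {t : ℝ≥0} {n : ℕ}
    (h1 : jumpTime r ω n ≤ t) (h2 : t < jumpTime r ω (n + 1)) : process r t ω = some (ω.1 n) := by
  classical
  have h : ∃ n, jumpTime r ω n ≤ t ∧ (t : ℝ≥0∞) < jumpTime r ω (n + 1) := ⟨n, h1, h2⟩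
  rw [process, dif_pos h]
  congr 1
  refine congrArg ω.1 ((Nat.find_eq_iff h).2 ⟨⟨h1, h2⟩, fun m hm hm' => ?_⟩)
  exact (hm'.2.trans_le ((jumpTime_mono r ω (Nat.succ_le_of_lt hm)).trans h1)).false

lemma exists_of_process_eq_some {r : E → E → ℝ≥0} {ω : Sample E} {t : ℝ≥0} {x : E}
    (h : process r t ω = some x) : ∃ n, ω.1 n = x ∧ (t : ℝ≥0∞) < jumpTime r ω (n + 1) := by
  classical
  rw [process] at h
  split_ifs at h with h'
  exact ⟨_, Option.some.inj h, (Nat.find_spec h').2⟩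

lemma jumpTime_ne_top {r : E → E → ℝ≥0} (h0 : ∀ x, holdingRate r x ≠ 0) (ω : Sample E) (n : ℕ) :
    jumpTime r ω n ≠ ∞ :=
  ENNReal.sum_ne_top.2 fun _ _ => ENNReal.div_ne_top ENNReal.ofReal_ne_top (h0 _)

lemma bddAbove_of_finite_visits {r : E → E → ℝ≥0} (h0 : ∀ x, holdingRate r x ≠ 0)
    {ω : Sample E} {x : E} (h : {n | ω.1 n = x}.Finite) :
    BddAbove {t : ℝ≥0 | process r t ω = some x} := by
  obtain ⟨N, hN⟩ := h.bddAbove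
  refine ⟨(jumpTime r ω (N + 1)).toNNReal, fun t ht => ?_⟩
  obtain ⟨n, hn, ht'⟩ := exists_of_process_eq_some ht
  rw [← ENNReal.coe_le_coe, ENNReal.coe_toNNReal (jumpTime_ne_top h0 ω _)]
  exact ht'.le.trans (jumpTime_mono r ω (Nat.succ_le_succ (hN hn)))

/-- If the path visits `x` infinitely often and infinitely many of the corresponding clocks are
larger than `1`, then it does not explode and comes back to `x` after any time. -/
lemma not_bddAbove_of_infinite {r : E → E → ℝ≥0} (h0 : ∀ x, holdingRate r x ≠ 0)
    (htop : ∀ x, holdingRate r x ≠ ∞) {ω : Sample E} {x : E}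
    (h : {n | n ∈ {n | ω.1 n = x} ∧ 1 < ω.2 n}.Infinite) :
    ¬ BddAbove {t : ℝ≥0 | process r t ω = some x} := by
  -- Each selected visit lasts at least `(holdingRate r x)⁻¹ > 0`, so the path does not explode.
  have hsum : ∑' n, holdingTime r ω n = ∞ := by
    refine top_unique ?_
    have : Infinite {n | n ∈ {n | ω.1 n = x} ∧ 1 < ω.2 n} := h.to_subtype
    calc ∞ = ∑' _ : {n | n ∈ {n | ω.1 n = x} ∧ 1 < ω.2 n}, (holdingRate r x)⁻¹ :=
          (ENNReal.tsum_const_eq_top_of_ne_zero (ENNReal.inv_ne_zero.2 (htop x))).symm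
      _ ≤ ∑' n : {n | n ∈ {n | ω.1 n = x} ∧ 1 < ω.2 n}, holdingTime r ω n := by
          refine ENNReal.tsum_le_tsum fun n => ?_
          rw [holdingTime, show ω.1 n = x from n.2.1, ENNReal.div_eq_inv_mul]
          refine le_mul_of_one_le_right' ?_
          exact ENNReal.one_le_ofReal.2 n.2.2.le
      _ ≤ _ := ENNReal.tsum_comp_le_tsum_of_injective Subtype.val_injective _
  rintro ⟨T, hT⟩
  rw [ENNReal.tsum_eq_iSup_nat] at hsum
  obtain ⟨N, hN⟩ := lt_iSup_iff.1 (hsum ▸ ENNReal.coe_lt_top : (T : ℝ≥0∞) < _)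
  obtain ⟨n, hn, hNn⟩ := h.exists_gt N
  have hlt : jumpTime r ω n < jumpTime r ω (n + 1) := by
    rw [jumpTime, jumpTime, Finset.sum_range_succ]
    refine ENNReal.lt_add_right (jumpTime_ne_top h0 ω n) (ENNReal.div_pos ?_ (htop _)).ne'
    simpa using zero_lt_one.trans hn.2
  have ht : ((jumpTime r ω n).toNNReal : ℝ≥0∞) = jumpTime r ω n :=
    ENNReal.coe_toNNReal (jumpTime_ne_top h0 ω n)
  have hp : process r (jumpTime r ω n).toNNReal ω = some x := by
    rw [process_eq_some ht.ge (ht.trans_lt hlt), hn.1]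
  have h1 := ENNReal.coe_le_coe.2 (hT hp)
  rw [ht] at h1
  exact (hN.trans_le ((jumpTime_mono r ω hNn.le).trans h1)).false

variable [MeasurableSpace E] [DiscreteMeasurableSpace E]

lemma transient_of_green_ne_top [Countable E] {r : E → E → ℝ≥0} (h0 : ∀ x, holdingRate r x ≠ 0)
    (h : ∀ x, green (fun x => jumpProb r x) x x ≠ ∞) : Transient r := by
  intro x
  have h1 : ∀ᵐ ω ∂pathLaw r x, {n | ω.1 n = x}.Finite :=
    Measure.quasiMeasurePreserving_fst.ae (ae_finite_visits (h x))
  filter_upwards [h1] with ω hω using bddAbove_of_finite_visits h0 hω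

/-- By Fubini, almost every jump trajectory gives bounded occupation times for almost all clocks.
With the trajectory fixed, its visits to `x` form a deterministic set of indices; were it infinite,
the clocks would almost surely make these times unbounded. -/
lemma Transient.green_ne_top [Countable E] {r : E → E → ℝ≥0} (h0 : ∀ x, holdingRate r x ≠ 0)
    (htop : ∀ x, holdingRate r x ≠ ∞) (h : Transient r) (x : E) :
    green (fun x => jumpProb r x) x x ≠ ∞ := by
  refine green_ne_top_of_ae_finite_visits ?_
  have h1 := Measure.ae_ae_of_ae_prod (h x)
  filter_upwards [h1] with Y hY
  by_contra hinf
  obtain ⟨e, he1, he2⟩ := (hY.and (ae_frequently_one_lt_clock hinf)).exists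
  exact not_bddAbove_of_infinite h0 htop (ω := (Y, e)) he2 he1

/-- A process with a single state is not transient. -/
lemma not_transient_of_subsingleton [Subsingleton E] {r : E → E → ℝ≥0} (hr : ∀ x, r x x = 0)
    (x : E) : ¬ Transient r := by
  intro h
  -- The first holding time is `e_0 / 0`, which is `∞` only for `e_0 > 0`, since `0 / 0 = 0` in
  -- `ℝ≥0∞`.
  have h1 : ∀ᵐ ω ∂pathLaw r x, 0 < ω.2 0 :=
    Measure.quasiMeasurePreserving_snd.ae (ae_clock_pos.mono fun e he => he 0)
  have : IsProbabilityMeasure (pathLaw r x) := by unfold pathLaw; infer_instance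
  obtain ⟨ω, hω, hpos⟩ := ((h x).and h1).exists
  obtain ⟨T, hT⟩ := hω
  have h0 : holdingRate r (ω.1 0) = 0 := by
    rw [holdingRate, ENNReal.tsum_eq_zero]
    intro y
    rw [Subsingleton.elim y (ω.1 0), hr, ENNReal.coe_zero]
  have hp : process r (T + 1) ω = some x := by
    rw [process_eq_some (n := 0), Subsingleton.elim (ω.1 0) x]
    · simp [jumpTime]
    · rw [jumpTime, Finset.sum_range_one, holdingTime, h0, ENNReal.div_zero]
      · exact ENNReal.coe_lt_top
      · simpa using hpos
  have := hT hp
  simp at this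

end Paths

/-! ### Subinvariance of stationary measures, from small-time asymptotics. -/

section Stationary

variable {E : Type*}

lemma coe_lt_div_holdingRate {r : E → E → ℝ≥0} {x : E} (h0 : holdingRate r x ≠ 0)
    (htop : holdingRate r x ≠ ∞) {t : ℝ≥0} {s : ℝ} :
    (t : ℝ≥0∞) < ENNReal.ofReal s / holdingRate r x ↔ (holdingRate r x).toReal * t < s := by
  rw [ENNReal.lt_div_iff_mul_lt (.inl h0) (.inl htop),
    ENNReal.lt_ofReal_iff_toReal_lt (ENNReal.mul_ne_top ENNReal.coe_ne_top htop),
    ENNReal.toReal_mul, mul_comm, ENNReal.coe_toReal]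

variable [MeasurableSpace E] [DiscreteMeasurableSpace E]

/-- The process is still at its starting point at time `t` if it has not jumped. -/
lemma ofReal_exp_le_pathLaw_process_self {r : E → E → ℝ≥0} (h0 : ∀ x, holdingRate r x ≠ 0)
    (htop : ∀ x, holdingRate r x ≠ ∞) (x : E) (t : ℝ≥0) :
    ENNReal.ofReal (Real.exp (-((holdingRate r x).toReal * t)))
      ≤ pathLaw r x {ω | process r t ω = some x} := by
  set l := (holdingRate r x).toReal
  have hlt : 0 ≤ l * t := mul_nonneg ENNReal.toReal_nonneg t.coe_nonneg
  have h1 : pathLaw r x ({Y | Y 0 ∈ ({x} : Set E)} ×ˢ {e | l * t < e 0})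
      = ENNReal.ofReal (Real.exp (-(l * t))) := by
    rw [pathLaw, Measure.prod_prod, jumpChainLaw_zero, Set.indicator_of_mem (Set.mem_singleton x),
      Pi.one_apply, one_mul, ← expMeasure_one_Ioi hlt]
    exact (measurePreserving_eval_infinitePi (fun _ : ℕ => expMeasure 1) 0).measure_preimage
      measurableSet_Ioi.nullMeasurableSet
  rw [← h1]
  refine measure_mono fun ω hω => ?_
  obtain ⟨hY, he⟩ := hω
  have hY : ω.1 0 = x := hY
  change process r t ω = some x
  rw [← hY]
  refine process_eq_some (by simp [jumpTime]) ?_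
  rw [jumpTime, Finset.sum_range_one, holdingTime, hY]
  exact (coe_lt_div_holdingRate (h0 x) (htop x)).2 he

/-- The process goes from `x` to `y` before time `t` if it jumps exactly once, to `y`. -/
lemma ofReal_mul_le_pathLaw_process [Countable E] {r : E → E → ℝ≥0}
    (h0 : ∀ x, holdingRate r x ≠ 0) (htop : ∀ x, holdingRate r x ≠ ∞) (x y : E) (t : ℝ≥0) :
    jumpProb r x y * (ENNReal.ofReal (1 - Real.exp (-((holdingRate r x).toReal * t)))
        * ENNReal.ofReal (Real.exp (-((holdingRate r y).toReal * t))))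
      ≤ pathLaw r x {ω | process r t ω = some y} := by
  set l := (holdingRate r x).toReal with hl
  set l' := (holdingRate r y).toReal with hl'
  have hlt : 0 ≤ l * t := mul_nonneg ENNReal.toReal_nonneg t.coe_nonneg
  have hlt' : 0 ≤ l' * t := mul_nonneg ENNReal.toReal_nonneg t.coe_nonneg
  have hY : jumpChainLaw r x {Y | Y 0 = x ∧ Y 1 = y} = jumpProb r x y := by
    have h := jumpChainLaw_succ r x 0 (B := Set.univ) .univ x y
    simp only [Set.mem_univ, true_and, zero_add] at h
    have h' := jumpChainLaw_zero r x {x}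
    rw [Set.indicator_of_mem (Set.mem_singleton x), Pi.one_apply] at h'
    rw [h]
    exact (congrArg (· * jumpProb r x y) h').trans (one_mul _)
  have he : (Measure.infinitePi fun _ : ℕ => expMeasure 1) {e | e 0 ≤ l * t ∧ l' * t < e 1}
      = expMeasure 1 (Set.Iic (l * t)) * expMeasure 1 (Set.Ioi (l' * t)) := by
    have h := Measure.infinitePi_pi (fun _ : ℕ => expMeasure 1) (s := {0, 1})
      (t := fun n => if n = 0 then Set.Iic (l * t) else Set.Ioi (l' * t)) (by
        intro n _
        split_ifs
        exacts [measurableSet_Iic, measurableSet_Ioi])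
    rw [Finset.prod_pair zero_ne_one] at h
    simp only [if_true, one_ne_zero, if_false] at h
    rw [← h]
    congr 1
    ext e
    simp
  have h1 : pathLaw r x ({Y | Y 0 = x ∧ Y 1 = y} ×ˢ {e | e 0 ≤ l * t ∧ l' * t < e 1})
      = jumpProb r x y * (ENNReal.ofReal (1 - Real.exp (-(l * t)))
        * ENNReal.ofReal (Real.exp (-(l' * t)))) := by
    rw [pathLaw, Measure.prod_prod, hY, he, expMeasure_one_Iic hlt, expMeasure_one_Ioi hlt']
  rw [← h1]
  refine measure_mono fun ω hω => ?_
  obtain ⟨⟨hY0, hY1⟩, he0, he1⟩ := hω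
  change process r t ω = some y
  rw [← hY1]
  refine process_eq_some ?_ ?_
  · rw [jumpTime, Finset.sum_range_one, holdingTime, hY0, ← not_lt,
      coe_lt_div_holdingRate (h0 x) (htop x)]
    exact he0.not_gt
  · rw [jumpTime, Finset.sum_range_succ]
    -- The second holding time alone exceeds `t`: more than needed, but this keeps the two clock
    -- conditions independent.
    refine lt_of_lt_of_le ?_ le_add_self
    rw [holdingTime, hY1]
    exact (coe_lt_div_holdingRate (h0 y) (htop y)).2 he1

/-- A stationary measure is subinvariant for the generator. -/
theorem IsStationary.isSubinvariant [Countable E] {r : E → E → ℝ≥0} {μ : E → ℝ≥0}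
    (hr : IsJumpRates r) (h0 : ∀ x, holdingRate r x ≠ 0) (h : IsStationary r μ) :
    IsSubinvariant r μ := by
  classical
  intro y
  have htop := hr.holdingRate_ne_top
  set l : E → ℝ := fun x => (holdingRate r x).toReal with hl
  have hlpos : ∀ x, 0 < l x := fun x => ENNReal.toReal_pos (h0 x) (htop x)
  rw [ENNReal.tsum_eq_iSup_sum]
  refine iSup_le fun F => ?_
  -- Stationarity at time `t`, keeping only paths from `y` without a jump and paths from `x ≠ y`
  -- with exactly one jump. Erasing `y` avoids counting its contribution twice and costs nothing, as
  -- `r y y = 0`.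
  have hbound : ∀ t : ℝ≥0, ∑ x ∈ F.erase y, (μ x : ℝ) * (r x y / l x)
      * ((1 - Real.exp (-(l x * t))) * Real.exp (-(l y * t))) + μ y * Real.exp (-(l y * t))
      ≤ μ y := by
    intro t
    have hpos : ∀ x, 0 ≤ 1 - Real.exp (-(l x * t)) := fun x => by
      have := mul_nonneg (hlpos x).le t.coe_nonneg
      simpa using this
    rw [← ENNReal.ofReal_le_ofReal_iff (μ y).coe_nonneg, ENNReal.ofReal_add _ (by positivity),
      ENNReal.ofReal_sum_of_nonneg]
    · calc _ ≤ ∑ x ∈ F.erase y, (μ x : ℝ≥0∞) * pathLaw r x {ω | process r t ω = some y}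
            + μ y * pathLaw r y {ω | process r t ω = some y} := by
            gcongr with x hx
            · rw [mul_assoc, ENNReal.ofReal_mul (μ x).coe_nonneg, ENNReal.ofReal_coe_nnreal]
              gcongr
              refine le_trans (le_of_eq ?_) (ofReal_mul_le_pathLaw_process h0 htop x y t)
              rw [ENNReal.ofReal_mul (div_nonneg (r x y).coe_nonneg (hlpos x).le),
                ENNReal.ofReal_mul (hpos x), jumpProb_apply (h0 x) (htop x),
                ENNReal.ofReal_div_of_pos (hlpos x), ENNReal.ofReal_coe_nnreal,
                ENNReal.ofReal_toReal (htop x)]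
            · rw [ENNReal.ofReal_mul (μ y).coe_nonneg, ENNReal.ofReal_coe_nnreal]
              gcongr
              exact ofReal_exp_le_pathLaw_process_self h0 htop y t
        _ = ∑ x ∈ insert y (F.erase y),
              (μ x : ℝ≥0∞) * pathLaw r x {ω | process r t ω = some y} := by
            rw [Finset.sum_insert (by simp), add_comm]
        _ ≤ ∑' x, (μ x : ℝ≥0∞) * pathLaw r x {ω | process r t ω = some y} :=
            ENNReal.sum_le_tsum _
        _ = μ y := h.2 t y
        _ = _ := (ENNReal.ofReal_coe_nnreal).symm
    · intro x _
      have := hpos x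
      have := hlpos x
      positivity
    · refine Finset.sum_nonneg fun x _ => ?_
      have := hpos x
      have := hlpos x
      positivity
  -- Division by `t`, using `1 - exp (-s) ≥ s exp (-s)` for the one-jump terms and `1 - exp (-s) ≤
  -- s` for the loss at `y`; letting `t → 0` then removes the exponentials.
  have hlin : ∀ t : ℝ≥0, 0 < t → ∑ x ∈ F.erase y, (μ x : ℝ) * r x y
      * (Real.exp (-(l x * t)) * Real.exp (-(l y * t))) ≤ μ y * l y := by
    intro t ht
    have ht' : (0 : ℝ) < t := ht
    refine le_of_mul_le_mul_right ?_ ht'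
    calc (∑ x ∈ F.erase y, (μ x : ℝ) * r x y
          * (Real.exp (-(l x * t)) * Real.exp (-(l y * t)))) * t
        ≤ ∑ x ∈ F.erase y, (μ x : ℝ) * (r x y / l x)
          * ((1 - Real.exp (-(l x * t))) * Real.exp (-(l y * t))) := by
          rw [Finset.sum_mul]
          refine Finset.sum_le_sum fun x _ => ?_
          have h1 : l x * t * Real.exp (-(l x * t)) ≤ 1 - Real.exp (-(l x * t)) := by
            have h2 := mul_le_mul_of_nonneg_right (Real.add_one_le_exp (l x * t))
              (Real.exp_pos (-(l x * t))).le
            rw [← Real.exp_add, add_neg_cancel, Real.exp_zero] at h2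
            linarith
          have hx := hlpos x
          calc _ = (μ x : ℝ) * (r x y / l x)
                * ((l x * t * Real.exp (-(l x * t))) * Real.exp (-(l y * t))) := by
                field_simp
            _ ≤ _ := by gcongr
      _ ≤ μ y * (1 - Real.exp (-(l y * t))) := by
          have := hbound t
          linarith
      _ ≤ μ y * (l y * t) := by
          have := Real.one_sub_le_exp_neg (l y * t)
          gcongr
          linarith
      _ = μ y * l y * t := by ring
  have hlim : ∑ x ∈ F.erase y, (μ x : ℝ) * r x y ≤ μ y * l y := by
    have hc : Continuous fun t : ℝ≥0 => ∑ x ∈ F.erase y, (μ x : ℝ) * r x y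
        * (Real.exp (-(l x * t)) * Real.exp (-(l y * t))) := by fun_prop
    have ht := (hc.tendsto 0).mono_left (nhdsWithin_le_nhds (s := Set.Ioi 0))
    simp only [NNReal.coe_zero, mul_zero, neg_zero, Real.exp_zero, mul_one] at ht
    exact le_of_tendsto ht (eventually_nhdsWithin_of_forall hlin)
  have hF : ∑ x ∈ F, (μ x : ℝ≥0∞) * r x y = ∑ x ∈ F.erase y, (μ x : ℝ≥0∞) * r x y :=
    (Finset.sum_erase F (by simp [hr.diag])).symm
  calc ∑ x ∈ F, (μ x : ℝ≥0∞) * r x y = ENNReal.ofReal (∑ x ∈ F.erase y, (μ x : ℝ) * r x y) := by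
        rw [hF, ENNReal.ofReal_sum_of_nonneg fun x _ => by positivity]
        refine Finset.sum_congr rfl fun x _ => ?_
        rw [ENNReal.ofReal_mul (μ x).coe_nonneg, ENNReal.ofReal_coe_nnreal, ENNReal.ofReal_coe_nnreal]
    _ ≤ ENNReal.ofReal (μ y * l y) := ENNReal.ofReal_le_ofReal hlim
    _ = μ y * holdingRate r y := by
        rw [ENNReal.ofReal_mul (μ y).coe_nonneg, ENNReal.ofReal_coe_nnreal, ENNReal.ofReal_toReal (htop y)]

end Stationary

end MarkovJump

theorem lemma4p1 {E : Type*} [Countable E] [MeasurableSpace E] [DiscreteMeasurableSpace E]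
    (r : E → E → ℝ≥0) (hr : MarkovJump.IsJumpRates r) (hirr : MarkovJump.Irreducible r)
    (μ : E → ℝ≥0) (hμ : MarkovJump.IsStationary r μ)
    (htr : MarkovJump.Transient (MarkovJump.symmetrizedRates r μ)) :
    MarkovJump.Transient r := by
  obtain ⟨x₀, hx₀⟩ := hμ.1
  -- Irreducibility forces positive holding rates only when there are at least two states; with a
  -- single one, the transience assumption fails.
  rcases subsingleton_or_nontrivial E with _ | _
  · refine absurd htr (MarkovJump.not_transient_of_subsingleton (fun x => ?_) x₀)
    simp [MarkovJump.symmetrizedRates, MarkovJump.adjointRates, hr.diag]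
  · have h0 := hirr.holdingRate_ne_zero
    have htop := hr.holdingRate_ne_top
    have hsub := hμ.isSubinvariant hr h0
    have hpos := hsub.ne_zero hirr hx₀
    have hs0 := (hirr.symmetrizedRates μ).holdingRate_ne_zero
    have hs1 := fun x =>
      ne_top_of_le_ne_top (htop x) (hsub.holdingRate_symmetrizedRates_le (hpos x))
    exact MarkovJump.transient_of_green_ne_top h0 fun x =>
      MarkovJump.green_ne_top_of_symmetrizedRates hirr h0 htop hs0 hpos hsub
        (htr.green_ne_top hs0 hs1 x)
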